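/- A local ring is a Noetherian commutative ring with exactly one maximal ideal, and its completion is its adic completion at that maximal ideal. Let $(R,M)$ be a local ring with completion $T$, and let $I$ be an ideal of $R$. Then there is a local ring $(S,N)$ and a local, injective, faithfully flat ring homomorphism $R\to S$ such that: 1. the completion of $S$ (at $N$) is isomorphic to $T$ as an $R$-algebra; 2. $S/IS\cong R/I$ as $R$-algebras, and in particular $\operatorname{Spec}(S/IS)$ and $\operatorname{Spec}(R/I)$ are homeomorphic; 3. for every chain $Q_1\subsetneq Q_2\subsetneq Q_3$ of prime ideals of $S$ with $IS\not\subseteq Q_1$, the set of prime ideals $Q'$ of $S$ with $Q_1\subsetneq Q'\subsetneq Q_3$ has cardinality exactly $|\operatorname{Spec} T|$. Moreover, if $I\neq R$, then the $I$-adic completion $S=\varprojlim_n R/I^n$ of $R$, with the canonical map $R\to S$, has all of these properties. -/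

import Mathlib

open IsLocalRing

universe u

/-- The properties asserted of an extension `S` of the (Noetherian) local ring `R`, relative to an
ideal `I` of `R`. "Local" includes Noetherian. The completion of a local ring is its adic completion
at its maximal ideal; `T` is `AdicCompletion (maximalIdeal R) R`. -/
structure IsPartialCompletionExtension {R : Type u} [CommRing R] [IsLocalRing R] (I : Ideal R)
    (S : Type u) [CommRing S] [Algebra R S] : Prop where
  /-- `S` is Noetherian and has exactly one maximal ideal. -/
  isNoetherianRing : IsNoetherianRing S
  [isLocalRing : IsLocalRing S]
  /-- `S` is an extension ring of `R`. -/
  injective : Function.Injective (algebraMap R S)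
  /-- `R → S` is a local homomorphism. -/
  isLocalHom : IsLocalHom (algebraMap R S)
  /-- `S` is faithfully flat over `R`. -/
  faithfullyFlat : Module.FaithfullyFlat R S
  /-- The completion of `S` is `T`, compatibly with the maps from `R`. -/
  completion : Nonempty
    (AdicCompletion (maximalIdeal S) S ≃ₐ[R] AdicCompletion (maximalIdeal R) R)
  /-- `S / IS ≅ R / I`. -/
  quotient : Nonempty ((S ⧸ I.map (algebraMap R S)) ≃ₐ[R] (R ⧸ I))
  /-- `Spec (S / IS) ≅ Spec (R / I)`. -/
  spec_quotient : Nonempty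
    (PrimeSpectrum (S ⧸ I.map (algebraMap R S)) ≃ₜ PrimeSpectrum (R ⧸ I))
  /-- For every chain `Q₁ ⊊ Q₂ ⊊ Q₃` of primes of `S` with `IS ⊄ Q₁`, there are exactly `|Spec T|`
  primes strictly between `Q₁` and `Q₃`. -/
  card_between : ∀ Q₁ Q₂ Q₃ : PrimeSpectrum S, Q₁ < Q₂ → Q₂ < Q₃ →
    ¬ I.map (algebraMap R S) ≤ Q₁.asIdeal →
    Cardinal.mk {Q : PrimeSpectrum S // Q₁ < Q ∧ Q < Q₃} =
      Cardinal.mk (PrimeSpectrum (AdicCompletion (maximalIdeal R) R))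

/-! For `I ≠ ⊤` take `S` to be the `I`-adic completion. It is a Noetherian local ring, flat over
`R`, and agrees with `R` modulo `I` and modulo every power of the maximal ideal; hence it has the
same completion `T`. Let `k` be the residue field. Given a chain as in the statement, everything
reduces to `|k| ^ ℵ₀ ≤ |(Q₁, Q₃)| ≤ |Spec S| ≤ |Spec T| ≤ |k| ^ ℵ₀`. The first inequality is the
main point (`residueField_pow_aleph0_le_mk_between`): completeness at `IS ⊄ Q₁` allows perturbing an
element by arbitrary power series in some `a ∈ IS`, and Krull's principal ideal theorem keeps the
resulting primes strictly below `Q₃`. The third is faithful flatness, and the last counts finite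
generating sets of ideals of `T`. -/

/-! ### Krull's theorem in a chain, and power series in one element -/

section PowerSeriesSums

variable {S : Type u} [CommRing S]

/-- In a Noetherian ring, a prime `Q₃` at the top of a chain of primes `Q₁ < Q₂ < Q₃` is not minimal over
`Q₁ ⊔ (x)`, by Krull's principal ideal theorem. -/
theorem notMem_minimalPrimes_sup_span_singleton [IsNoetherianRing S] {Q₁ Q₂ Q₃ : Ideal S}
    [Q₁.IsPrime] [Q₂.IsPrime] [Q₃.IsPrime] (h₁₂ : Q₁ < Q₂) (h₂₃ : Q₂ < Q₃) (x : S) :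
    Q₃ ∉ (Q₁ ⊔ Ideal.span {x}).minimalPrimes := by
  intro hmin
  have hle := Ideal.map_height_le_one_of_mem_minimalPrimes hmin
  have h₁₃ : Q₁ ≤ Q₃ := (h₁₂.trans h₂₃).le
  have hp₂ : (Q₂.map (Ideal.Quotient.mk Q₁)).IsPrime :=
    Ideal.map_isPrime_of_surjective Ideal.Quotient.mk_surjective (by simpa using h₁₂.le)
  have hp₃ : (Q₃.map (Ideal.Quotient.mk Q₁)).IsPrime :=
    Ideal.map_isPrime_of_surjective Ideal.Quotient.mk_surjective (by simpa using h₁₃)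
  have key : ∀ P : Ideal S, Q₁ ≤ P →
      (P.map (Ideal.Quotient.mk Q₁)).comap (Ideal.Quotient.mk Q₁) = P :=
    fun P hP ↦ by simpa using hP
  have hlt₂₃ : Q₂.map (Ideal.Quotient.mk Q₁) < Q₃.map (Ideal.Quotient.mk Q₁) := by
    refine lt_of_le_of_ne (Ideal.map_mono h₂₃.le) fun h ↦ h₂₃.ne ?_
    rw [← key Q₂ h₁₂.le, h, key Q₃ h₁₃]
  have hlt₁₂ : (⊥ : Ideal (S ⧸ Q₁)) < Q₂.map (Ideal.Quotient.mk Q₁) := by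
    refine bot_lt_iff_ne_bot.2 fun h ↦ h₁₂.ne ?_
    rw [← key Q₂ h₁₂.le, h, ← RingHom.ker_eq_comap_bot, Ideal.mk_ker]
  have h₁ : (1 : ℕ∞) < (Q₃.map (Ideal.Quotient.mk Q₁)).height := by
    have h := Ideal.height_strict_mono_of_isPrime_of_isPrime hlt₂₃
    refine lt_of_le_of_lt (Order.one_le_iff_ne_zero.2 fun h₀ ↦ ?_) h
    have h' := Ideal.height_strict_mono_of_isPrime_of_isPrime hlt₁₂
    rw [h₀] at h'
    exact not_lt_zero h'
  exact absurd hle (not_le.2 h₁)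

/-- In a ring complete at an ideal containing `a`, power series in `a` can be summed. -/
theorem exists_power_series_sum (J : Ideal S) [IsAdicComplete J S] {a : S} (ha : a ∈ J) :
    ∃ G : (ℕ → S) → S, ∀ u, G u = u 0 + a * G (fun n ↦ u (n + 1)) := by
  have hex : ∀ u : ℕ → S, ∃ L, ∀ n,
      ∑ i ∈ Finset.range n, u i * a ^ i ≡ L [SMOD (J ^ n • ⊤ : Submodule S S)] := fun u ↦ by
    refine IsPrecomplete.prec inferInstance fun {m n} hmn ↦ ?_
    rw [SModEq.comm, SModEq.sub_mem, ← Finset.sum_Ico_eq_sub _ hmn, smul_eq_mul, Ideal.mul_top]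
    refine Ideal.sum_mem _ fun i hi ↦ Ideal.mul_mem_left _ _ ?_
    exact Ideal.pow_le_pow_right (Finset.mem_Ico.1 hi).1 (Ideal.pow_mem_pow ha i)
  choose G hG using hex
  refine ⟨G, fun u ↦ ?_⟩
  refine (IsHausdorff.eq_iff_smodEq (I := J)).2 fun n ↦ ?_
  -- The first `n + 1` terms of `u` are `u 0` plus `a` times the first `n` terms of its shift.
  have h₁ := hG u (n + 1)
  have h₂ := hG (fun n ↦ u (n + 1)) n
  rw [SModEq.sub_mem, smul_eq_mul, Ideal.mul_top] at h₁ h₂ ⊢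
  have e : G u - (u 0 + a * G fun n ↦ u (n + 1)) =
      a * (∑ i ∈ Finset.range n, u (i + 1) * a ^ i - G fun n ↦ u (n + 1)) -
      (∑ i ∈ Finset.range (n + 1), u i * a ^ i - G u) := by
    rw [Finset.sum_range_succ', mul_sub, Finset.mul_sum]
    simp only [pow_succ]
    ring_nf
  rw [e]
  exact sub_mem (Ideal.mul_mem_left _ _ h₂) (Ideal.pow_le_pow_right n.le_succ h₁)

/-- Two power series in `a ∈ 𝔪` whose coefficients first differ at `n`, by a unit, have sums that
differ by `aⁿ` times a unit. -/
theorem exists_isUnit_sub_eq_pow_mul [IsLocalRing S] {a : S} (ha : a ∈ maximalIdeal S)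
    {G : (ℕ → S) → S} (hG : ∀ u, G u = u 0 + a * G (fun n ↦ u (n + 1))) (n : ℕ) (u v : ℕ → S)
    (h : ∀ i < n, u i = v i) (hn : IsUnit (u n - v n)) :
    ∃ w, IsUnit w ∧ G u - G v = a ^ n * w := by
  induction n generalizing u v with
  | zero =>
    refine ⟨_, ?_, (by rw [pow_zero, one_mul])⟩
    rw [hG u, hG v]
    by_contra hnu
    have hmem := (mem_maximalIdeal _).2 hnu
    refine (mem_maximalIdeal _).1 ?_ hn
    have : u 0 - v 0 = (u 0 + a * G (fun n ↦ u (n + 1)) - (v 0 + a * G fun n ↦ v (n + 1))) -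
      a * (G (fun n ↦ u (n + 1)) - G fun n ↦ v (n + 1)) := by ring
    rw [this]
    exact sub_mem hmem (Ideal.mul_mem_right _ _ ha)
  | succ n ih =>
    obtain ⟨w, hw, e⟩ := ih (fun n ↦ u (n + 1)) (fun n ↦ v (n + 1))
      (fun i hi ↦ h _ (Nat.succ_lt_succ hi)) hn
    refine ⟨w, hw, ?_⟩
    rw [hG u, hG v, h 0 n.succ_pos, add_sub_add_left_eq_sub, ← mul_sub, e, pow_succ']
    ring

end PowerSeriesSums

/-! ### Lower bound for the primes in an interval -/

section LowerBound

open Cardinal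

variable {S : Type u} [CommRing S] [IsNoetherianRing S] [IsLocalRing S]

/-- Between the ends of a chain `Q₁ < Q₂ < Q₃` of primes there are at least `|k| ^ ℵ₀` primes, if the
ring is complete at an ideal not contained in `Q₁`: the primes minimal over `Q₁ ⊔ (b + a f(a))`, for
suitable `a`, `b` and varying power series `f`, are distinct. -/
theorem residueField_pow_aleph0_le_mk_between (J : Ideal S) [IsAdicComplete J S]
    (Q₁ Q₂ Q₃ : PrimeSpectrum S) (h₁₂ : Q₁ < Q₂) (h₂₃ : Q₂ < Q₃) (hJ : ¬ J ≤ Q₁.asIdeal) :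
    #(ResidueField S) ^ ℵ₀ ≤ #{Q : PrimeSpectrum S // Q₁ < Q ∧ Q < Q₃} := by
  have h₁₃ : Q₁ < Q₃ := h₁₂.trans h₂₃
  obtain ⟨a₁, ha₁J, ha₁⟩ := SetLike.not_le_iff_exists.1 hJ
  obtain ⟨a₂, ha₂, ha₂'⟩ := SetLike.not_le_iff_exists.1
    (not_le_of_gt (show Q₁.asIdeal < Q₃.asIdeal from h₁₃))
  obtain ⟨a, haJ, ha₃, haQ₁⟩ : ∃ a, a ∈ J ∧ a ∈ Q₃.asIdeal ∧ a ∉ Q₁.asIdeal :=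
    ⟨a₁ * a₂, Ideal.mul_mem_right _ _ ha₁J, Ideal.mul_mem_left _ _ ha₂, fun h ↦
      (Q₁.2.mem_or_mem h).elim ha₁ ha₂'⟩
  have ham : a ∈ maximalIdeal S := le_maximalIdeal Q₃.2.ne_top ha₃
  have hle₃ : Q₁.asIdeal ⊔ Ideal.span {a} ≤ Q₃.asIdeal :=
    sup_le h₁₃.le ((Ideal.span_singleton_le_iff_mem _).2 ha₃)
  -- Prime avoidance: if `Q₃` lay in the finite union of these minimal primes, it would be one of
  -- them, against Krull.
  obtain ⟨b, hb₃, hb⟩ : ∃ b ∈ Q₃.asIdeal,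
      ∀ P ∈ (Q₁.asIdeal ⊔ Ideal.span {a}).minimalPrimes, b ∉ P := by
    have hfin := Ideal.finite_minimalPrimes_of_isNoetherianRing S (Q₁.asIdeal ⊔ Ideal.span {a})
    by_contra! hcon
    have hsub : (Q₃.asIdeal : Set S) ⊆ ⋃ P ∈ (hfin.toFinset : Set (Ideal S)), (P : Set S) := by
      intro b hb
      obtain ⟨P, hP, hbP⟩ := hcon b hb
      simp only [Set.mem_iUnion]
      exact ⟨P, by simpa using hP, hbP⟩
    obtain ⟨P, hP, hle⟩ := (Ideal.subset_union_prime (f := id) ⊥ ⊥ fun P hP _ _ ↦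
      ((hfin.mem_toFinset).1 hP).1.1).1 hsub
    have hP := (hfin.mem_toFinset).1 hP
    have heq : P = Q₃.asIdeal := le_antisymm (hP.2 ⟨Q₃.2, hle₃⟩ hle) hle
    exact notMem_minimalPrimes_sup_span_singleton (Q₁ := Q₁.asIdeal) (Q₂ := Q₂.asIdeal)
      h₁₂ h₂₃ a (heq ▸ hP)
  obtain ⟨G, hG⟩ := exists_power_series_sum J haJ
  obtain ⟨σ, hσ⟩ := (residue_surjective (R := S)).hasRightInverse
  let c : (ℕ → ResidueField S) → S := fun u ↦ b + a * G fun n ↦ σ (u n)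
  have hc₃ : ∀ u, Q₁.asIdeal ⊔ Ideal.span {c u} ≤ Q₃.asIdeal := fun u ↦
    sup_le h₁₃.le ((Ideal.span_singleton_le_iff_mem _).2
      (add_mem hb₃ (Ideal.mul_mem_right _ _ ha₃)))
  choose P hP hPle using fun u ↦ Ideal.exists_minimalPrimes_le (hc₃ u)
  have hPp : ∀ u, (P u).IsPrime := fun u ↦ (hP u).1.1
  have hQ₁P : ∀ u, Q₁.asIdeal ≤ P u := fun u ↦ le_sup_left.trans (hP u).1.2
  have hcP : ∀ u, c u ∈ P u := fun u ↦
    (hP u).1.2 (Ideal.mem_sup_right (Ideal.mem_span_singleton_self _))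
  -- If `a ∈ P u`, then also `b ∈ P u`, so a prime minimal over `Q₁ ⊔ (a)` lies strictly between
  -- `Q₁` and `P u`, although `P u` is minimal over `Q₁ ⊔ (c u)`.
  have haP : ∀ u, a ∉ P u := fun u hau ↦ by
    have hbu : b ∈ P u := by
      have := sub_mem (hcP u) (Ideal.mul_mem_right (G fun n ↦ σ (u n)) _ hau)
      simpa [c] using this
    obtain ⟨P', hP', hle⟩ := Ideal.exists_minimalPrimes_le
      (sup_le (hQ₁P u) ((Ideal.span_singleton_le_iff_mem _).2 hau))
    have := hP'.1.1
    refine notMem_minimalPrimes_sup_span_singleton (Q₁ := Q₁.asIdeal) (Q₂ := P') (Q₃ := P u)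
      ?_ ?_ (c u) (hP u)
    · refine lt_of_le_of_ne (le_sup_left.trans hP'.1.2) fun h ↦ haQ₁ ?_
      rw [h]
      exact hP'.1.2 (Ideal.mem_sup_right (Ideal.mem_span_singleton_self _))
    · exact lt_of_le_of_ne hle fun h ↦ hb P' hP' (h ▸ hbu)
  have hlt : ∀ u, Q₁ < ⟨P u, hPp u⟩ ∧ (⟨P u, hPp u⟩ : PrimeSpectrum S) < Q₃ := fun u ↦ by
    constructor
    · refine lt_of_le_of_ne (hQ₁P u) fun h ↦ ?_
      have hcu : c u ∈ Q₁.asIdeal := by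
        rw [h]
        exact hcP u
      obtain ⟨P', hP', -⟩ := Ideal.exists_minimalPrimes_le hle₃
      have haP' : a ∈ P' := hP'.1.2 (Ideal.mem_sup_right (Ideal.mem_span_singleton_self _))
      have := sub_mem (hP'.1.2 (Ideal.mem_sup_left hcu))
        (Ideal.mul_mem_right (G fun n ↦ σ (u n)) _ haP')
      exact hb P' hP' (by simpa [c] using this)
    · refine lt_of_le_of_ne (hPle u) fun h ↦ ?_
      have h' : P u = Q₃.asIdeal := congrArg PrimeSpectrum.asIdeal h
      exact notMem_minimalPrimes_sup_span_singleton (Q₁ := Q₁.asIdeal) (Q₂ := Q₂.asIdeal)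
        h₁₂ h₂₃ (c u) (h' ▸ hP u)
  have hinj : Function.Injective P := fun u v huv ↦ by
    by_contra hne
    have hex : ∃ n, u n ≠ v n := Function.ne_iff.1 hne
    classical
    obtain ⟨w, hw, e⟩ := exists_isUnit_sub_eq_pow_mul ham hG (Nat.find hex) (fun n ↦ σ (u n))
      (fun n ↦ σ (v n)) (fun i hi ↦ by
        have := Nat.find_min hex hi
        simp only [not_not] at this
        simp only [this]) (by
        rw [← residue_ne_zero_iff_isUnit, map_sub, hσ, hσ, sub_ne_zero]
        exact Nat.find_spec hex)
    -- This element is `c u - c v`; a prime containing it contains `a` or a unit.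
    have hmem : a * (a ^ Nat.find hex * w) ∈ P u := by
      rw [← e]
      have := sub_mem (hcP u) (huv ▸ hcP v)
      simpa [c, mul_sub] using this
    have := hPp u
    rcases (hPp u).mem_or_mem hmem with h | h
    · exact haP u h
    rcases (hPp u).mem_or_mem h with h | h
    · exact haP u ((hPp u).mem_of_pow_mem _ h)
    · exact (hPp u).ne_top (Ideal.eq_top_of_isUnit_mem _ h hw)
  have := mk_le_of_injective (f := fun u : ℕ → ResidueField S ↦
    (⟨⟨P u, hPp u⟩, hlt u⟩ : {Q : PrimeSpectrum S // Q₁ < Q ∧ Q < Q₃})) fun u v h ↦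
      hinj (congrArg (fun Q ↦ Q.1.asIdeal) h)
  simpa using this

end LowerBound

/-! ### Upper bound for the spectrum of a Noetherian local ring -/

section UpperBound

open Cardinal

/-- Since `m ^ n / m ^ (n + 1)` is finitely generated over `S ⧸ m`, each step multiplies the
cardinality by at most a finite power of `#(S ⧸ m)`, which an infinite `κ` absorbs. -/
theorem mk_quotient_pow_le {S : Type u} [CommRing S] [IsNoetherianRing S] {κ : Cardinal.{u}}
    (hκ : ℵ₀ ≤ κ) (m : Ideal S) (hm : #(S ⧸ m) ≤ κ) (n : ℕ) : #(S ⧸ m ^ n) ≤ κ := by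
  induction n with
  | zero =>
    rw [pow_zero, Ideal.one_eq_top]
    exact (le_one_iff_subsingleton.2 inferInstance).trans (one_le_aleph0.trans hκ)
  | succ n ih =>
    obtain ⟨r, g, hg⟩ := Submodule.fg_iff_exists_fin_generating_family.1
      (IsNoetherian.noetherian (m ^ n))
    let φ : (S ⧸ m ^ n) × (Fin r → S ⧸ m) → S ⧸ m ^ (n + 1) := fun p ↦
      Ideal.Quotient.mk _ (p.1.out + ∑ i, (p.2 i).out * g i)
    have hφ : Function.Surjective φ := fun y ↦ by
      obtain ⟨y, rfl⟩ := Ideal.Quotient.mk_surjective y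
      have h₁ : y - (Ideal.Quotient.mk (m ^ n) y).out ∈ m ^ n := by
        rw [← Ideal.Quotient.eq]
        exact (Ideal.Quotient.mk_out _).symm
      obtain ⟨d, hd⟩ := (Submodule.mem_span_range_iff_exists_fun S).1 (hg.ge h₁)
      refine ⟨(Ideal.Quotient.mk _ y, fun i ↦ Ideal.Quotient.mk _ (d i)), ?_⟩
      refine Ideal.Quotient.eq.2 ?_
      have e : (Ideal.Quotient.mk (m ^ n) y).out +
          ∑ i, (Ideal.Quotient.mk m (d i)).out * g i - y =
          ∑ i, ((Ideal.Quotient.mk m (d i)).out - d i) * g i := by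
        simp only [sub_mul, Finset.sum_sub_distrib]
        simp only [smul_eq_mul] at hd
        rw [hd]
        ring
      simp only
      rw [e, pow_succ']
      refine Ideal.sum_mem _ fun i _ ↦ Ideal.mul_mem_mul ?_ (hg ▸ Submodule.subset_span ⟨i, rfl⟩)
      rw [← Ideal.Quotient.eq]
      exact Ideal.Quotient.mk_out _
    refine (mk_le_of_surjective hφ).trans ?_
    rw [mk_prod, lift_id, lift_id]
    refine (mul_le_mul' ih ?_).trans (mul_eq_self hκ).le
    rw [mk_pi, prod_const, mk_fin, lift_natCast, power_natCast, lift_id'.{0, u}]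
    exact (pow_le_pow_left' hm r).trans (power_natCast κ r ▸ power_nat_le hκ)

variable {S : Type u} [CommRing S] [IsNoetherianRing S] [IsLocalRing S]

omit [IsNoetherianRing S] in
theorem aleph0_le_residueField_pow : ℵ₀ ≤ #(ResidueField S) ^ ℵ₀ :=
  (cantor ℵ₀).le.trans (power_le_power_right (two_le_iff.2 ⟨0, 1, zero_ne_one⟩))

/-- By Krull's intersection theorem `S` embeds in the product of the `S ⧸ 𝔪 ^ n`. -/
theorem mk_le_residueField_pow_aleph0 : #S ≤ #(ResidueField S) ^ ℵ₀ := by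
  have hinj : Function.Injective fun (x : S) (n : ℕ) ↦ Ideal.Quotient.mk (maximalIdeal S ^ n) x :=
    fun x y h ↦ by
      rw [← sub_eq_zero, ← Ideal.mem_bot, ← Ideal.iInf_pow_eq_bot_of_isLocalRing (maximalIdeal S)
        (Ideal.IsPrime.ne_top inferInstance), Ideal.mem_iInf]
      exact fun n ↦ Ideal.Quotient.eq.1 (congrFun h n)
  have h := mk_le_of_injective hinj
  rw [mk_pi] at h
  refine h.trans ((prod_le_prod _ (fun _ ↦ #(ResidueField S) ^ ℵ₀) fun n ↦
    mk_quotient_pow_le aleph0_le_residueField_pow _ ?_ n).trans ?_)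
  · exact self_le_power _ one_le_aleph0
  · simp [← power_mul]

theorem mk_primeSpectrum_le_residueField_pow_aleph0 :
    #(PrimeSpectrum S) ≤ #(ResidueField S) ^ ℵ₀ := by
  have h₁ : #(PrimeSpectrum S) ≤ #(Ideal S) :=
    mk_le_of_injective (f := PrimeSpectrum.asIdeal) fun _ _ ↦ PrimeSpectrum.ext
  have h₂ : #(Ideal S) ≤ #(List S) :=
    mk_le_of_surjective (f := fun l : List S ↦ Ideal.span {x | x ∈ l}) fun I ↦ by
      obtain ⟨s, hs⟩ := IsNoetherian.noetherian I
      exact ⟨s.toList, by simpa using hs⟩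
  exact h₁.trans (h₂.trans ((mk_list_le_max S).trans
    (max_le aleph0_le_residueField_pow mk_le_residueField_pow_aleph0)))

end UpperBound

/-! ### Adic completions of Noetherian local rings -/

namespace AdicCompletion

variable {R : Type u} [CommRing R]

theorem ker_evalₐ_eq_map {I : Ideal R} (h : I.FG) (n : ℕ) :
    RingHom.ker (evalₐ I n) = (I ^ n).map (algebraMap R (AdicCompletion I R)) := by
  ext x
  have e : x ∈ RingHom.ker (evalₐ I n) ↔ x ∈ (eval I R n).ker := by
    rw [RingHom.mem_ker, LinearMap.mem_ker,
      ← factor_evalₐ_eq_eval I x (le_of_eq (Ideal.mul_top _).symm)]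
    refine ⟨fun h ↦ (congrArg _ h).trans (RingHom.map_zero _), fun h ↦ ?_⟩
    obtain ⟨y, hy⟩ := Ideal.Quotient.mk_surjective (evalₐ I n x)
    rw [← hy, Ideal.Quotient.factor_mk, Ideal.Quotient.eq_zero_iff_mem, smul_eq_mul,
      Ideal.mul_top] at h
    rw [← hy, Ideal.Quotient.eq_zero_iff_mem]
    exact h
  rw [e, ← pow_smul_top_eq_ker_eval h, ← Submodule.restrictScalars_mem R (Ideal.map _ _),
    ← Ideal.smul_top_eq_map]

/-- Modulo an ideal containing a power of `I`, a ring and its `I`-adic completion agree. -/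
theorem bijective_quotient_of_pow_le {I : Ideal R} (hI : I.FG) {J : Ideal R} {n : ℕ}
    (hJ : I ^ n ≤ J) :
    Function.Bijective (Ideal.quotientMapₐ (J.map (algebraMap R (AdicCompletion I R)))
      (Algebra.ofId R (AdicCompletion I R)) Ideal.le_comap_map) := by
  constructor
  · rw [injective_iff_map_eq_zero]
    intro x hx
    obtain ⟨x, rfl⟩ := Ideal.Quotient.mk_surjective x
    have hx : algebraMap R (AdicCompletion I R) x ∈ J.map (algebraMap R (AdicCompletion I R)) :=
      Ideal.Quotient.eq_zero_iff_mem.1 hx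
    have h := Ideal.mem_map_of_mem (evalₐ I n) hx
    have hle : ((J.map (algebraMap R (AdicCompletion I R))).map (evalₐ I n)) ≤
        J.map (Ideal.Quotient.mk (I ^ n)) := by
      rw [← Ideal.map_coe (evalₐ I n), Ideal.map_map]
      exact (congrArg (Ideal.map · J) (evalₐ I n).comp_algebraMap).le
    have h' := hle h
    rw [show evalₐ I n (algebraMap R _ x) = Ideal.Quotient.mk _ x from (evalₐ I n).commutes x,
      Ideal.mem_quotient_iff_mem hJ] at h'
    exact Ideal.Quotient.eq_zero_iff_mem.2 h'
  · intro y
    obtain ⟨y, rfl⟩ := Ideal.Quotient.mk_surjective y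
    obtain ⟨x, hx⟩ := Ideal.Quotient.mk_surjective (evalₐ I n y)
    refine ⟨Ideal.Quotient.mk J x, Ideal.Quotient.eq.2 (Ideal.map_mono hJ ?_)⟩
    rw [← ker_evalₐ_eq_map hI, RingHom.mem_ker, map_sub, sub_eq_zero, ← hx]
    exact (evalₐ I n).commutes x

/-- The isomorphism `R ⧸ J ≃ R̂ ⧸ JR̂`, where `R̂` is the `I`-adic completion of `R` and `Iⁿ ≤ J`. -/
noncomputable def quotientEquivOfPowLE {I : Ideal R} (hI : I.FG) {J : Ideal R} {n : ℕ}
    (hJ : I ^ n ≤ J) :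
    (R ⧸ J) ≃ₐ[R] (AdicCompletion I R ⧸ J.map (algebraMap R (AdicCompletion I R))) :=
  AlgEquiv.ofBijective _ (bijective_quotient_of_pow_le hI hJ)

theorem factor_evalₐ {I : Ideal R} {m n : ℕ} (h : m ≤ n) (x : AdicCompletion I R) :
    Ideal.Quotient.factor (Ideal.pow_le_pow_right h) (evalₐ I n x) = evalₐ I m x := by
  induction x using AdicCompletion.induction_on with
  | h x =>
    simp only [evalₐ_mk, Ideal.Quotient.factor_mk]
    exact Ideal.mk_eq_mk I h x

/-- Algebras that agree modulo all powers of the ideals have the same completion. -/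
noncomputable def algEquivOfQuotientPow {S : Type u} [CommRing S] [Algebra R S] (m : Ideal R)
    (n : Ideal S) (e : ∀ k : ℕ, (R ⧸ m ^ k) ≃ₐ[R] (S ⧸ n ^ k)) :
    AdicCompletion m R ≃ₐ[R] AdicCompletion n S :=
  have h {i j : ℕ} (hij : i ≤ j) (x : R ⧸ m ^ j) :
      Ideal.Quotient.factor (Ideal.pow_le_pow_right hij) (e j x) =
        e i (Ideal.Quotient.factor (Ideal.pow_le_pow_right hij) x) := by
    obtain ⟨x, rfl⟩ := Ideal.Quotient.mk_surjective x
    rw [Ideal.Quotient.factor_mk, ← Ideal.Quotient.algebraMap_eq, ← Ideal.Quotient.algebraMap_eq,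
      AlgEquiv.commutes, AlgEquiv.commutes]
    rfl
  have h' {i j : ℕ} (hij : i ≤ j) (x : S ⧸ n ^ j) :
      Ideal.Quotient.factor (Ideal.pow_le_pow_right hij) ((e j).symm x) =
        (e i).symm (Ideal.Quotient.factor (Ideal.pow_le_pow_right hij) x) := by
    rw [AlgEquiv.eq_symm_apply, ← h hij, AlgEquiv.apply_symm_apply]
  let f : AdicCompletion m R →ₐ[R] AdicCompletion n S :=
    liftAlgHom n (fun k ↦ (e k).toAlgHom.comp (evalₐ m k)) fun {i j} hij ↦ by
      ext x
      exact (h hij _).trans (congrArg (e i) (factor_evalₐ hij x))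
  let g : AdicCompletion n S →ₐ[R] AdicCompletion m R :=
    liftAlgHom m (fun k ↦ (e k).symm.toAlgHom.comp ((evalₐ n k).restrictScalars R))
      fun {i j} hij ↦ by
        ext x
        exact (h' hij _).trans (congrArg (e i).symm (factor_evalₐ hij x))
  AlgEquiv.ofAlgHom f g (AlgHom.ext fun x ↦ ext_evalₐ fun k ↦ by simp [f, g])
    (AlgHom.ext fun x ↦ ext_evalₐ fun k ↦ by simp [f, g])

variable (I : Ideal R)

/-- An adic completion of a Noetherian ring is Noetherian, as a quotient of a power series ring. -/
theorem isNoetherianRing [IsNoetherianRing R] : IsNoetherianRing (AdicCompletion I R) := by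
  obtain ⟨r, a, ha⟩ := Submodule.fg_iff_exists_fin_generating_family.1 (IsNoetherian.noetherian I)
  let J := MvPolynomial.idealOfVars (Fin r) R
  let φ : MvPolynomial (Fin r) R →ₐ[R] R := MvPolynomial.aeval a
  have hφ : J.map φ = I := by
    rw [Ideal.map_span, ← Set.range_comp, ← ha]
    congr 2
    ext i
    simp [φ]
  have hle (n : ℕ) : J ^ n ≤ (I ^ n).comap φ := by
    rw [← Ideal.map_le_iff_le_comap, Ideal.map_pow, hφ]
  let f (n : ℕ) : AdicCompletion J (MvPolynomial (Fin r) R) →+* R ⧸ I ^ n :=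
    (Ideal.quotientMap (I ^ n) (φ : _ →+* R) (hle n)).comp (evalₐ J n).toRingHom
  have hf {m n : ℕ} (h : m ≤ n) : (Ideal.Quotient.factorPow I h).comp (f n) = f m := by
    ext x
    obtain ⟨y, hy⟩ := Ideal.Quotient.mk_surjective (evalₐ J n x)
    change Ideal.Quotient.factorPow I h (Ideal.quotientMap _ _ (hle n) (evalₐ J n x)) =
      Ideal.quotientMap _ _ (hle m) (evalₐ J m x)
    rw [← factor_evalₐ h x, ← hy]
    rfl
  let ψ : AdicCompletion J (MvPolynomial (Fin r) R) →+* AdicCompletion I R := liftRingHom I f hf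
  have hψ (p : MvPolynomial (Fin r) R) : ψ (algebraMap _ _ p) = algebraMap R _ (φ p) :=
    ext_evalₐ fun n ↦ (evalₐ_liftRingHom I f hf n _).trans rfl
  let J' := J.map (algebraMap _ (AdicCompletion J (MvPolynomial (Fin r) R)))
  have hJ' : J'.map ψ = I.map (algebraMap R _) := by
    trans (J.map φ).map (algebraMap R _)
    · rw [Ideal.map_map, ← Ideal.map_coe φ, Ideal.map_map]
      exact congrArg (Ideal.map · J) (RingHom.ext hψ)
    · rw [hφ]
  have : IsAdicComplete J' (AdicCompletion J (MvPolynomial (Fin r) R)) :=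
    isAdicComplete_self J (MvPolynomial.idealOfVars_fg _ _)
  have hc : IsAdicComplete (J'.map ψ) (AdicCompletion I R) :=
    hJ' ▸ isAdicComplete_self I (IsNoetherian.noetherian I)
  -- By completeness, surjectivity need only be checked modulo `J'`, where constants suffice.
  have hsurj : Function.Surjective ψ := by
    refine surjective_of_mk_map_comp_surjective (I := J') ψ fun y ↦ ?_
    obtain ⟨y, rfl⟩ := Ideal.Quotient.mk_surjective y
    obtain ⟨x, hx⟩ := Ideal.Quotient.mk_surjective (evalₐ I 1 y)
    refine ⟨algebraMap (MvPolynomial (Fin r) R) _ (MvPolynomial.C x), Ideal.Quotient.eq.2 ?_⟩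
    rw [hψ, hJ']
    have : RingHom.ker (evalₐ I 1) = I.map (algebraMap R _) := by
      rw [ker_evalₐ_eq_map (IsNoetherian.noetherian I), pow_one]
    rw [← this, RingHom.mem_ker, map_sub, sub_eq_zero, ← hx]
    simp [φ]
  have : IsNoetherianRing (AdicCompletion J (MvPolynomial (Fin r) R)) :=
    isNoetherianRing_of_ringEquiv _ (MvPowerSeries.toAdicCompletionAlgEquiv (Fin r) R).toRingEquiv
  exact isNoetherianRing_of_surjective _ _ ψ hsurj

section IsLocalRing

variable [IsNoetherianRing R] [IsLocalRing R] {I : Ideal R} (hI : I ≠ ⊤)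

include hI

/-- The extension of `I` lies in the Jacobson radical, so locality descends from the quotient by it,
which is `R ⧸ I`. -/
theorem isLocalRing_of_ne_top : IsLocalRing (AdicCompletion I R) := by
  have hc := isAdicComplete_self I (IsNoetherian.noetherian I)
  have := isLocalHom_of_le_jacobson_bot _
    (IsAdicComplete.le_jacobson_bot (I.map (algebraMap R (AdicCompletion I R))))
  have : Nontrivial (R ⧸ I) := Ideal.Quotient.nontrivial_iff.2 hI
  have : IsLocalRing (R ⧸ I) := .of_surjective' _ Ideal.Quotient.mk_surjective
  have : IsLocalRing (AdicCompletion I R ⧸ I.map (algebraMap R (AdicCompletion I R))) :=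
    (quotientEquivOfPowLE (IsNoetherian.noetherian I) (pow_one I).le).toRingEquiv.isLocalRing
  exact RingHom.domain_isLocalRing (Ideal.Quotient.mk (I.map (algebraMap R (AdicCompletion I R))))

theorem map_maximalIdeal_eq [IsLocalRing (AdicCompletion I R)] :
    (maximalIdeal R).map (algebraMap R (AdicCompletion I R)) =
      maximalIdeal (AdicCompletion I R) :=
  have := isMaximal_map_of_le I _ (le_maximalIdeal hI) (IsNoetherian.noetherian I)
  IsLocalRing.eq_maximalIdeal this

theorem isLocalHom_of_ne_top : IsLocalHom (algebraMap R (AdicCompletion I R)) := by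
  have := isLocalRing_of_ne_top hI
  refine ((IsLocalRing.local_hom_TFAE _).out 0 2).mpr ?_
  rw [map_maximalIdeal_eq hI]

end IsLocalRing

end AdicCompletion

/-! ### Counting primes and conclusion -/

open Cardinal in
theorem mk_between_eq_mk_primeSpectrum_completion {S : Type u} [CommRing S] [IsNoetherianRing S]
    [IsLocalRing S] (J : Ideal S) [IsAdicComplete J S] (Q₁ Q₂ Q₃ : PrimeSpectrum S)
    (h₁₂ : Q₁ < Q₂) (h₂₃ : Q₂ < Q₃) (hJ : ¬ J ≤ Q₁.asIdeal) :
    #{Q : PrimeSpectrum S // Q₁ < Q ∧ Q < Q₃} =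
      #(PrimeSpectrum (AdicCompletion (maximalIdeal S) S)) := by
  have := AdicCompletion.isNoetherianRing (maximalIdeal S)
  have hff : Module.FaithfullyFlat S (AdicCompletion (maximalIdeal S) S) :=
    .of_flat_of_isLocalHom
  have hres : #(ResidueField (AdicCompletion (maximalIdeal S) S)) = #(ResidueField S) :=
    (mk_congr (.ofBijective _ (AdicCompletion.residueField_map_bijective S))).symm
  have hsub := mk_subtype_le fun Q : PrimeSpectrum S ↦ Q₁ < Q ∧ Q < Q₃
  have hlow := residueField_pow_aleph0_le_mk_between J Q₁ Q₂ Q₃ h₁₂ h₂₃ hJ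
  refine le_antisymm (hsub.trans (mk_le_of_surjective
    (PrimeSpectrum.comap_surjective_of_faithfullyFlat
      (A := S) (B := AdicCompletion (maximalIdeal S) S)))) (le_trans ?_ hlow)
  rw [← hres]
  exact mk_primeSpectrum_le_residueField_pow_aleph0

theorem AdicCompletion.isPartialCompletionExtension {R : Type u} [CommRing R] [IsNoetherianRing R]
    [IsLocalRing R] {I : Ideal R} (hI : I ≠ ⊤) :
    IsPartialCompletionExtension I (AdicCompletion I R) := by
  have hfg : I.FG := IsNoetherian.noetherian I
  have := isLocalRing_of_ne_top hI
  have := isLocalHom_of_ne_top hI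
  have := AdicCompletion.isNoetherianRing I
  have hff : Module.FaithfullyFlat R (AdicCompletion I R) := .of_flat_of_isLocalHom
  have := isAdicComplete_self I hfg
  let q := quotientEquivOfPowLE hfg (pow_one I).le
  let e : AdicCompletion (maximalIdeal R) R ≃ₐ[R]
      AdicCompletion (maximalIdeal (AdicCompletion I R)) (AdicCompletion I R) :=
    algEquivOfQuotientPow _ _ fun k ↦
      (quotientEquivOfPowLE hfg (Ideal.pow_right_mono (le_maximalIdeal hI) k)).trans
        (Ideal.quotientEquivAlgOfEq R (by rw [Ideal.map_pow, map_maximalIdeal_eq hI]))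
  exact {
    isNoetherianRing := inferInstance
    isLocalRing := inferInstance
    injective := FaithfulSMul.algebraMap_injective _ _
    isLocalHom := inferInstance
    faithfullyFlat := inferInstance
    completion := ⟨e.symm⟩
    quotient := ⟨q.symm⟩
    spec_quotient := ⟨PrimeSpectrum.homeomorphOfRingEquiv q.symm.toRingEquiv⟩
    card_between := fun Q₁ Q₂ Q₃ h₁₂ h₂₃ h ↦
      (mk_between_eq_mk_primeSpectrum_completion _ Q₁ Q₂ Q₃ h₁₂ h₂₃ h).trans
        (Cardinal.mk_congr (PrimeSpectrum.homeomorphOfRingEquiv e.symm.toRingEquiv).toEquiv) }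

/-- The completion of `R` at its maximal ideal also serves for the unit ideal. -/
theorem AdicCompletion.isPartialCompletionExtension_top {R : Type u} [CommRing R]
    [IsNoetherianRing R] [IsLocalRing R] :
    IsPartialCompletionExtension (⊤ : Ideal R) (AdicCompletion (maximalIdeal R) R) := by
  have h := isPartialCompletionExtension (I := maximalIdeal R) (Ideal.IsPrime.ne_top inferInstance)
  have : Subsingleton (AdicCompletion (maximalIdeal R) R ⧸
      (⊤ : Ideal R).map (algebraMap R (AdicCompletion (maximalIdeal R) R))) :=
    Ideal.Quotient.subsingleton_iff.2 (Ideal.map_top _)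
  let q : (AdicCompletion (maximalIdeal R) R ⧸
      (⊤ : Ideal R).map (algebraMap R (AdicCompletion (maximalIdeal R) R))) ≃ₐ[R] (R ⧸ (⊤ : Ideal R)) :=
    { toFun := 0
      invFun := 0
      left_inv := fun _ ↦ Subsingleton.elim _ _
      right_inv := fun _ ↦ Subsingleton.elim _ _
      map_mul' := fun _ _ ↦ Subsingleton.elim _ _
      map_add' := fun _ _ ↦ Subsingleton.elim _ _
      commutes' := fun _ ↦ Subsingleton.elim _ _ }
  exact { h with
    quotient := ⟨q⟩
    spec_quotient := ⟨PrimeSpectrum.homeomorphOfRingEquiv q.toRingEquiv⟩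
    -- The count for the maximal ideal applies: `Q₁ < Q₂` prevents `Q₁` from containing the maximal
    -- ideal.
    card_between := fun Q₁ Q₂ Q₃ h₁₂ h₂₃ _ ↦ h.card_between Q₁ Q₂ Q₃ h₁₂ h₂₃ fun hle ↦ by
      rw [← maximalIdeal_eq_map] at hle
      exact absurd (hle.trans_lt (show Q₁.asIdeal < Q₂.asIdeal from h₁₂))
        (not_lt_of_ge (le_maximalIdeal Q₂.2.ne_top)) }

theorem theorem4p8 {R : Type u} [CommRing R] [IsNoetherianRing R] [IsLocalRing R] (I : Ideal R) :
    (∃ (S : Type u) (_ : CommRing S) (_ : Algebra R S), IsPartialCompletionExtension I S) ∧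
    (I ≠ ⊤ → IsPartialCompletionExtension I (AdicCompletion I R)) := by
  refine ⟨?_, AdicCompletion.isPartialCompletionExtension⟩
  -- For `I = ⊤` the `I`-adic completion is the zero ring, so another extension is needed.
  by_cases hI : I = ⊤
  · subst hI
    exact ⟨_, _, _, AdicCompletion.isPartialCompletionExtension_top⟩
  · exact ⟨_, _, _, AdicCompletion.isPartialCompletionExtension hI⟩
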